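/- Let $n\in\mathbb{N}$ and let $p_1,\dots,p_n>0$ be real numbers (strengths, not necessarily summing to $1$). The gladiator chain is the Markov chain on the set $S_n$ of permutations of $[n]=\{1,\dots,n\}$ in which a state $\pi$ assigns to each gladiator $i$ its rank $\pi(i)$, and which moves as follows: choose $k\in[n-1]$ uniformly at random and let $i=\pi^{-1}(k)$ and $j=\pi^{-1}(k+1)$; with probability $\frac{p_j}{p_i+p_j}$ the gladiators $i$ and $j$ exchange their ranks, and otherwise the ranking is unchanged (if $n\le 1$, the chain stays put). This chain has a unique stationary distribution, and for $\pi$ drawn from it and all $j\in[n]$, \[ \mathbb{E}\Biggl[\,\sum_{i\colon \pi(i)>\pi(j)}\max\{p_i-p_j,\,0\}\Biggr]\le p_j . \] -/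

import Mathlib

open scoped BigOperators Matrix

noncomputable section

/-- The rank with (zero-based) index `k`, the better of the two adjacent ranks `k`, `k + 1`. -/
def upperRank {n : ℕ} (k : Fin (n - 1)) : Fin n := ⟨k.val, by omega⟩

/-- The rank with (zero-based) index `k + 1`. -/
def lowerRank {n : ℕ} (k : Fin (n - 1)) : Fin n := ⟨k.val + 1, by omega⟩

/-- The ranking obtained from `π` (a map from gladiators to ranks) when the gladiators at the
adjacent ranks `k` and `k + 1` exchange their ranks. -/
def exchangeAt {n : ℕ} (k : Fin (n - 1)) (π : Equiv.Perm (Fin n)) : Equiv.Perm (Fin n) :=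
  π.trans (Equiv.swap (upperRank k) (lowerRank k))

/-- The probability of moving from the ranking `π` to the ranking `σ` through a fight between the
gladiator `i` at rank `k` and the gladiator `j` at rank `k + 1`: gladiator `j` wins with
probability `p j / (p i + p j)` and then the two exchange their ranks; otherwise `i` wins and
the ranking is unchanged. -/
def fightProb {n : ℕ} (p : Fin n → ℝ) (k : Fin (n - 1)) (π σ : Equiv.Perm (Fin n)) : ℝ :=
  let i := π.symm (upperRank k)
  let j := π.symm (lowerRank k)
  (if σ = exchangeAt k π then p j / (p i + p j) else 0) + (if σ = π then p i / (p i + p j) else 0)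

/-- The transition matrix of the gladiator chain with strengths `p`: the pair of adjacent ranks
`k`, `k + 1` that fights is uniform among the `n - 1` such pairs. If there is no such pair
(`n ≤ 1`) the chain stays put. -/
def gladiatorChain {n : ℕ} (p : Fin n → ℝ) :
    Matrix (Equiv.Perm (Fin n)) (Equiv.Perm (Fin n)) ℝ :=
  Matrix.of fun π σ =>
    if n ≤ 1 then (if σ = π then 1 else 0)
    else ∑ k : Fin (n - 1), (1 / ((n : ℝ) - 1)) * fightProb p k π σ

/-- `μ` is a stationary distribution of the Markov chain with transition matrix `P` on a finite
state space: a probability vector with `μ P = μ`. -/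
def IsStationaryDistribution {S : Type*} [Fintype S] (P : Matrix S S ℝ) (μ : S → ℝ) : Prop :=
  μ ∈ stdSimplex ℝ S ∧ μ ᵥ* P = μ

/-- The expectation of `f` under the probability vector `μ` on a finite set. -/
def expectation {S : Type*} [Fintype S] (μ f : S → ℝ) : ℝ := ∑ s, μ s * f s

/-- The total excess strength, over gladiator `j`, of the stronger gladiators that are ranked
below `j` in the ranking `π`. -/
def excessBelow {n : ℕ} (p : Fin n → ℝ) (j : Fin n) (π : Equiv.Perm (Fin n)) : ℝ :=
  ∑ i with π j < π i, max (p i - p j) 0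

end

/-!
The chain satisfies detailed balance with respect to the weights `w π = ∏ i, p i ^ (n - 1 - π i)`,
and adjacent transpositions generate the symmetric group, so `w` normalizes to the unique stationary
distribution.

For the inequality fix a gladiator `c` and a set `A` of gladiators at least as strong as `c`, and
let `B π` be the set of those `i ∈ A` that `π` ranks below `c`, the best ranked of them being `a`.

* Exchanging `a` with `i` is an involution on the pairs `(π, i)` with `i ∈ B π`. As `w` favours the
  stronger gladiator in front, pairing each term with its image shows that the sum of `w π * p i`
  over these pairs is at most that of `w π * p a`, that is, `∑ π, #(B π) * w π * p a`.
* Exchanging `c` with `a` gives a ranking `π'` with `w π * p a ≤ w π' * p c` and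
  `#(B π) = #(B π') + 1`. As `π` can be recovered from `π'`, that sum is at most
  `∑ π', (#(B π') + 1) * w π' * p c`.

Hence `∑ π, w π * ∑ i ∈ B π, (p i - p c) ≤ p c * ∑ π, w π`.
-/

open Finset Equiv

/-- The detailed balance equations, which say that a Markov chain with transition matrix `P` is
reversible with respect to the weights `w`. The weights need not be normalized. -/
def DetailedBalance {S : Type*} (P : Matrix S S ℝ) (w : S → ℝ) : Prop :=
  ∀ s t, w s * P s t = w t * P t s

section Reversible

variable {S : Type*} [Fintype S] {P : Matrix S S ℝ} {w μ h : S → ℝ}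

theorem eq_of_isIrreducible_of_mulVec_eq (hP : P.IsIrreducible) (hrow : ∀ s, ∑ t, P s t = 1)
    (hh : P *ᵥ h = h) (s t : S) : h s = h t := by
  obtain ⟨m, -, h_le⟩ := exists_max_image univ h ⟨s, mem_univ s⟩
  have eq_of_step (u v : S) (hu : h u = h m) (huv : 0 < P u v) : h v = h m := by
    have h_sum : ∑ x, P u x * (h m - h x) = 0 := by
      have h_harm : ∑ x, P u x * h x = h u := congrFun hh u
      simp only [mul_sub, sum_sub_distrib, ← sum_mul, hrow, h_harm, hu, one_mul, sub_self]
    have h_term := (sum_eq_zero_iff_of_nonneg fun x _ =>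
      mul_nonneg (hP.nonneg u x) (sub_nonneg.2 (h_le x (mem_univ x)))).1 h_sum v (mem_univ v)
    exact (sub_eq_zero.1 ((mul_eq_zero.1 h_term).resolve_left huv.ne')).symm
  have eq_max (u : S) : h u = h m := by
    let := P.toQuiver
    obtain ⟨path, -⟩ := hP.connected m u
    induction path with
    | nil => rfl
    | cons _ e ih => exact eq_of_step _ _ ih e.down
  rw [eq_max s, eq_max t]

theorem DetailedBalance.vecMul_eq (hPw : DetailedBalance P w) (hrow : ∀ s, ∑ t, P s t = 1) :
    w ᵥ* P = w := by
  ext t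
  calc ∑ s, w s * P s t = w t * ∑ s, P t s := by
        rw [mul_sum]
        exact sum_congr rfl fun s _ => hPw s t
    _ = w t := by rw [hrow, mul_one]

theorem DetailedBalance.mulVec_div (hPw : DetailedBalance P w) (hw : ∀ s, w s ≠ 0) (μ : S → ℝ) :
    P *ᵥ (μ / w) = μ ᵥ* P / w := by
  ext s
  simp only [Matrix.mulVec, Matrix.vecMul, dotProduct, Pi.div_apply, sum_div]
  refine sum_congr rfl fun t _ => ?_
  have := hw s
  have := hw t
  field_simp
  linear_combination μ t * hPw s t

theorem DetailedBalance.isStationaryDistribution_iff [Nonempty S] (hPw : DetailedBalance P w)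
    (hw : ∀ s, 0 < w s) (hP : P.IsIrreducible) (hrow : ∀ s, ∑ t, P s t = 1) :
    IsStationaryDistribution P μ ↔ μ = (∑ s, w s)⁻¹ • w := by
  have h_total : 0 < ∑ s, w s := sum_pos (fun s _ => hw s) univ_nonempty
  constructor
  · rintro ⟨⟨-, hμ1⟩, hμP⟩
    have h_harm : P *ᵥ (μ / w) = μ / w := by rw [hPw.mulVec_div fun s => (hw s).ne', hμP]
    ext s
    have h_prop (t : S) : μ t = μ s / w s * w t := by
      rw [← Pi.div_apply, eq_of_isIrreducible_of_mulVec_eq hP hrow h_harm s t, Pi.div_apply,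
        div_mul_cancel₀ _ (hw t).ne']
    have h_ratio : μ s / w s * ∑ t, w t = 1 := by
      rw [← hμ1, mul_sum]
      exact sum_congr rfl fun t _ => (h_prop t).symm
    rw [h_prop s, eq_inv_of_mul_eq_one_left h_ratio, Pi.smul_apply, smul_eq_mul]
  · rintro rfl
    refine ⟨⟨fun s => mul_nonneg (inv_pos.2 h_total).le (hw s).le, ?_⟩, ?_⟩
    · simp only [Pi.smul_apply, smul_eq_mul, ← mul_sum, inv_mul_cancel₀ h_total.ne']
    · rw [Matrix.smul_vecMul, hPw.vecMul_eq hrow]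

end Reversible

/-- The weight of the ranking `π` in the stationary distribution of the gladiator chain, before
normalization. Ranks are zero-based, so the exponent `(π i).rev` is the number of gladiators that
`π` ranks below `i`. -/
def rankingWeight {n : ℕ} (p : Fin n → ℝ) (π : Perm (Fin n)) : ℝ :=
  ∏ i, p i ^ ((π i).rev : ℕ)

section RankingWeight

variable {n : ℕ} {p : Fin n → ℝ} {π : Perm (Fin n)} {a b : Fin n}

theorem rankingWeight_pos (hp : ∀ i, 0 < p i) (π : Perm (Fin n)) : 0 < rankingWeight p π :=
  prod_pos fun i _ => pow_pos (hp i) _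

theorem rankingWeight_mul_pow (p : Fin n → ℝ) (h : π a < π b) :
    rankingWeight p π * p b ^ (π b - π a : ℕ) =
      rankingWeight p (π * swap a b) * p a ^ (π b - π a : ℕ) := by
  have hab : a ≠ b := fun e => h.ne (congrArg π e)
  have h_others : ∏ i ∈ univ \ {a, b}, p i ^ ((π (swap a b i)).rev : ℕ) =
      ∏ i ∈ univ \ {a, b}, p i ^ ((π i).rev : ℕ) := by
    refine prod_congr rfl fun i hi => ?_
    simp only [mem_sdiff, mem_univ, true_and, mem_insert, mem_singleton, not_or] at hi
    rw [swap_apply_of_ne_of_ne hi.1 hi.2]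
  have h_rev : ((π a).rev : ℕ) = (π b).rev + (π b - π a : ℕ) := by
    simp only [Fin.val_rev]
    omega
  simp only [rankingWeight, ← prod_sdiff (subset_univ {a, b}), h_others, prod_pair hab,
    Perm.mul_apply, swap_apply_left, swap_apply_right, h_rev, pow_add]
  ring

theorem rankingWeight_mul_le (hp : ∀ i, 0 < p i) (hab : p a ≤ p b) (h : π a < π b) :
    rankingWeight p π * p b ≤ rankingWeight p (π * swap a b) * p a := by
  obtain ⟨d, hd⟩ : ∃ d, (π b - π a : ℕ) = d + 1 := ⟨π b - π a - 1, by omega⟩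
  have h_pow := rankingWeight_mul_pow p h
  rw [hd, pow_succ', pow_succ', ← mul_assoc, ← mul_assoc] at h_pow
  have h_nonneg := (mul_pos (rankingWeight_pos hp (π * swap a b)) (hp a)).le
  refine le_of_mul_le_mul_right ?_ (pow_pos (hp b) d)
  rw [h_pow]
  gcongr
  exact (hp a).le

theorem sub_mul_rankingWeight_sub_nonneg (hp : ∀ i, 0 < p i) (h : π a < π b) :
    0 ≤ (p a - p b) * (rankingWeight p π - rankingWeight p (π * swap a b)) := by
  have h_pow := rankingWeight_mul_pow p h
  have hπ := (rankingWeight_pos hp π).le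
  have hσ := (rankingWeight_pos hp (π * swap a b)).le
  rcases le_total (p a) (p b) with hab | hba
  · refine mul_nonneg_of_nonpos_of_nonpos (sub_nonpos.2 hab) (sub_nonpos.2 ?_)
    refine le_of_mul_le_mul_right ?_ (pow_pos (hp b) (π b - π a : ℕ))
    rw [h_pow]
    gcongr
    exact (hp a).le
  · refine mul_nonneg (sub_nonneg.2 hba) (sub_nonneg.2 ?_)
    refine le_of_mul_le_mul_right ?_ (pow_pos (hp a) (π b - π a : ℕ))
    rw [← h_pow]
    gcongr
    exact (hp b).le

end RankingWeight

section ExchangeAt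

variable {n : ℕ} (k : Fin (n - 1)) (π : Perm (Fin n))

theorem upperRank_lt_lowerRank : upperRank k < lowerRank k :=
  Nat.lt_succ_self k

theorem exchangeAt_eq_mul_swap :
    exchangeAt k π = π * swap (π.symm (upperRank k)) (π.symm (lowerRank k)) := by
  rw [mul_swap_eq_swap_mul, apply_symm_apply, apply_symm_apply]
  rfl

theorem exchangeAt_ne_self : exchangeAt k π ≠ π := by
  rw [exchangeAt_eq_mul_swap, Ne, mul_eq_left, Perm.one_def, swap_eq_refl_iff,
    π.symm.injective.eq_iff]
  exact (upperRank_lt_lowerRank k).ne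

theorem exchangeAt_exchangeAt : exchangeAt k (exchangeAt k π) = π := by
  ext i
  simp [exchangeAt]

theorem exchangeAt_induction {motive : Perm (Fin n) → Prop} {τ : Perm (Fin n)} (base : motive τ)
    (step : ∀ k π, motive π → motive (exchangeAt k π)) (π : Perm (Fin n)) : motive π := by
  cases n with
  | zero => rwa [Subsingleton.elim π τ]
  | succ m =>
    suffices h : ∀ g, motive (g * τ) by simpa using h (π * τ⁻¹)
    intro g
    induction g using Submonoid.induction_of_closure_eq_top_left
      (Perm.mclosure_swap_castSucc_succ m) with
    | one => exact base
    | mul_left x hx y ih =>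
      obtain ⟨i, rfl⟩ := hx
      exact step i (y * τ) ih

end ExchangeAt

section GladiatorChain

variable {n : ℕ} {p : Fin n → ℝ}

theorem fightProb_nonneg (hp : ∀ i, 0 < p i) (k : Fin (n - 1)) (π σ : Perm (Fin n)) :
    0 ≤ fightProb p k π σ := by
  have h_win (i j l : Fin n) : 0 ≤ p l / (p i + p j) :=
    (div_pos (hp l) (add_pos (hp i) (hp j))).le
  exact add_nonneg (ite_nonneg (h_win _ _ _) le_rfl) (ite_nonneg (h_win _ _ _) le_rfl)

theorem fightProb_exchangeAt (p : Fin n → ℝ) (k : Fin (n - 1)) (π : Perm (Fin n)) :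
    fightProb p k π (exchangeAt k π) = p (π.symm (lowerRank k)) /
      (p (π.symm (upperRank k)) + p (π.symm (lowerRank k))) := by
  simp only [fightProb, exchangeAt_ne_self, if_true, if_false, add_zero]

theorem fightProb_self (p : Fin n → ℝ) (k : Fin (n - 1)) (π : Perm (Fin n)) :
    fightProb p k π π = p (π.symm (upperRank k)) /
      (p (π.symm (upperRank k)) + p (π.symm (lowerRank k))) := by
  simp only [fightProb, (exchangeAt_ne_self k π).symm, if_true, if_false, zero_add]

theorem sum_fightProb (hp : ∀ i, 0 < p i) (k : Fin (n - 1)) (π : Perm (Fin n)) :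
    ∑ σ, fightProb p k π σ = 1 := by
  simp only [fightProb, sum_add_distrib, sum_ite_eq', mem_univ, if_true]
  rw [← add_div, add_comm, div_self (add_pos (hp _) (hp _)).ne']

theorem rankingWeight_exchangeAt (p : Fin n → ℝ) (k : Fin (n - 1)) (π : Perm (Fin n)) :
    rankingWeight p π * p (π.symm (lowerRank k)) =
      rankingWeight p (exchangeAt k π) * p (π.symm (upperRank k)) := by
  have h_pow := rankingWeight_mul_pow p (π := π) (a := π.symm (upperRank k))
    (b := π.symm (lowerRank k)) (by simpa using upperRank_lt_lowerRank k)
  rw [exchangeAt_eq_mul_swap]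
  simpa [upperRank, lowerRank] using h_pow

theorem detailedBalance_fightProb (p : Fin n → ℝ) (k : Fin (n - 1)) :
    DetailedBalance (fightProb p k) (rankingWeight p) := by
  intro π σ
  by_cases h_self : σ = π
  · rw [h_self]
  by_cases h_exchange : σ = exchangeAt k π
  · have h_back : fightProb p k (exchangeAt k π) π = p (π.symm (upperRank k)) /
        (p (π.symm (upperRank k)) + p (π.symm (lowerRank k))) := by
      have := fightProb_exchangeAt p k (exchangeAt k π)
      rw [exchangeAt_exchangeAt] at this
      simpa [exchangeAt, add_comm] using this
    rw [h_exchange, fightProb_exchangeAt, h_back, ← mul_div_assoc, rankingWeight_exchangeAt,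
      mul_div_assoc]
  · have h_exchange' : π ≠ exchangeAt k σ := fun h => h_exchange (by rw [h, exchangeAt_exchangeAt])
    simp [fightProb, h_self, h_exchange, h_exchange', Ne.symm h_self]

theorem gladiatorChain_of_le_one (hn : n ≤ 1) (p : Fin n → ℝ) : gladiatorChain p = 1 := by
  ext π σ
  simp [gladiatorChain, hn, Matrix.one_apply, eq_comm]

theorem gladiatorChain_of_one_lt (hn : 1 < n) (p : Fin n → ℝ) (π σ : Perm (Fin n)) :
    gladiatorChain p π σ = (n - 1 : ℝ)⁻¹ * ∑ k, fightProb p k π σ := by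
  simp [gladiatorChain, hn.not_ge, mul_sum]

theorem sum_gladiatorChain (hp : ∀ i, 0 < p i) (π : Perm (Fin n)) :
    ∑ σ, gladiatorChain p π σ = 1 := by
  rcases le_or_gt n 1 with hn | hn
  · simp [gladiatorChain_of_le_one hn, Matrix.one_apply]
  · have hn' : (n - 1 : ℝ) ≠ 0 := (sub_pos.2 (by exact_mod_cast hn)).ne'
    simp only [gladiatorChain_of_one_lt hn, ← mul_sum]
    rw [sum_comm]
    simp [sum_fightProb hp, Nat.cast_sub hn.le, hn']

theorem detailedBalance_gladiatorChain (p : Fin n → ℝ) :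
    DetailedBalance (gladiatorChain p) (rankingWeight p) := by
  intro π σ
  rcases le_or_gt n 1 with hn | hn
  · have : Subsingleton (Fin n) := Fin.subsingleton_iff_le_one.2 hn
    rw [Subsingleton.elim π σ]
  · simp only [gladiatorChain_of_one_lt hn, mul_left_comm _ (n - 1 : ℝ)⁻¹, mul_sum,
      detailedBalance_fightProb p _ π σ]

theorem gladiatorChain_nonneg (hp : ∀ i, 0 < p i) (π σ : Perm (Fin n)) :
    0 ≤ gladiatorChain p π σ := by
  rcases le_or_gt n 1 with hn | hn
  · rw [gladiatorChain_of_le_one hn, Matrix.one_apply]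
    exact ite_nonneg zero_le_one le_rfl
  · rw [gladiatorChain_of_one_lt hn]
    exact mul_nonneg (inv_nonneg.2 (sub_nonneg.2 (by exact_mod_cast hn.le)))
      (sum_nonneg fun k _ => fightProb_nonneg hp k π σ)

theorem gladiatorChain_pos (hp : ∀ i, 0 < p i) {k : Fin (n - 1)} {π σ : Perm (Fin n)}
    (h : 0 < fightProb p k π σ) : 0 < gladiatorChain p π σ := by
  have hn : 1 < n := by have := k.isLt; omega
  rw [gladiatorChain_of_one_lt hn]
  exact mul_pos (inv_pos.2 (sub_pos.2 (by exact_mod_cast hn)))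
    (sum_pos' (fun l _ => fightProb_nonneg hp l π σ) ⟨k, mem_univ k, h⟩)

theorem gladiatorChain_exchangeAt_pos (hp : ∀ i, 0 < p i) (k : Fin (n - 1)) (π : Perm (Fin n)) :
    0 < gladiatorChain p π (exchangeAt k π) := by
  refine gladiatorChain_pos hp (k := k) ?_
  rw [fightProb_exchangeAt]
  exact div_pos (hp _) (add_pos (hp _) (hp _))

theorem gladiatorChain_self_pos (hp : ∀ i, 0 < p i) (π : Perm (Fin n)) :
    0 < gladiatorChain p π π := by
  rcases le_or_gt n 1 with hn | hn
  · rw [gladiatorChain_of_le_one hn, Matrix.one_apply_eq]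
    exact one_pos
  · refine gladiatorChain_pos hp (k := ⟨0, by omega⟩) ?_
    rw [fightProb_self]
    exact div_pos (hp _) (add_pos (hp _) (hp _))

theorem isIrreducible_gladiatorChain (hp : ∀ i, 0 < p i) : (gladiatorChain p).IsIrreducible := by
  refine ⟨gladiatorChain_nonneg hp, ?_⟩
  let := (gladiatorChain p).toQuiver
  have h_connected : Quiver.IsStronglyConnected (Perm (Fin n)) := fun τ =>
    exchangeAt_induction ⟨.nil⟩ fun k π ⟨path⟩ =>
      ⟨path.cons ⟨gladiatorChain_exchangeAt_pos hp k π⟩⟩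
  exact h_connected.isSStronglyConnected_of_hom (i₀ := 1) ⟨gladiatorChain_self_pos hp 1⟩

end GladiatorChain

section Below

variable {α : Type*} [LinearOrder α]

/-- The members of `A` that the ranking `π` places below `c`. A lower place is a larger rank. -/
def below (A : Finset α) (c : α) (π : Perm α) : Finset α := {i ∈ A | π c < π i}

/-- The best ranked of the members of `A` that the ranking `π` places below `c`, with the junk value
`c` if there are none. -/
noncomputable def nextBelow (A : Finset α) (c : α) (π : Perm α) : α :=
  if h : (below A c π).Nonempty then (exists_min_image _ π h).choose else c

/-- The ranking obtained from `π` when `c` exchanges ranks with the next member of `A` below it. -/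
noncomputable def demote (A : Finset α) (c : α) (π : Perm α) : Perm α :=
  π * swap c (nextBelow A c π)

variable {A : Finset α} {c a i : α} {π : Perm α}

theorem mem_below : i ∈ below A c π ↔ i ∈ A ∧ π c < π i :=
  mem_filter

theorem ne_of_mem_below (hi : i ∈ below A c π) : i ≠ c :=
  fun h => (mem_below.1 hi).2.ne' (congrArg π h)

theorem nextBelow_mem (h : (below A c π).Nonempty) : nextBelow A c π ∈ below A c π := by
  rw [nextBelow, dif_pos h]
  exact (exists_min_image _ π h).choose_spec.1

theorem apply_nextBelow_le (hi : i ∈ below A c π) : π (nextBelow A c π) ≤ π i := by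
  have h : (below A c π).Nonempty := ⟨i, hi⟩
  rw [nextBelow, dif_pos h]
  exact (exists_min_image _ π h).choose_spec.2 i hi

theorem nextBelow_eq_of_forall_le (ha : a ∈ below A c π) (h : ∀ i ∈ below A c π, π a ≤ π i) :
    nextBelow A c π = a :=
  π.injective ((apply_nextBelow_le ha).antisymm (h _ (nextBelow_mem ⟨a, ha⟩)))

theorem below_mul_swap (ha : a ∈ below A c π) (hi : i ∈ below A c π) :
    below A c (π * swap a i) = below A c π := by
  have h_fix : swap a i c = c :=
    swap_apply_of_ne_of_ne (ne_of_mem_below ha).symm (ne_of_mem_below hi).symm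
  ext l
  rcases eq_or_ne l a with rfl | hla
  · simp_all [mem_below]
  rcases eq_or_ne l i with rfl | hli
  · simp_all [mem_below]
  · simp [mem_below, h_fix, swap_apply_of_ne_of_ne hla hli]

theorem nextBelow_mul_swap (hi : i ∈ below A c π) :
    nextBelow A c (π * swap (nextBelow A c π) i) = i := by
  have h_next := nextBelow_mem ⟨i, hi⟩
  have h_below := below_mul_swap h_next hi
  refine nextBelow_eq_of_forall_le (h_below ▸ hi) fun l hl => ?_
  have h_swap : swap (nextBelow A c π) i l ∈ below A c π := by
    rw [swap_apply_def]
    split_ifs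
    exacts [hi, h_next, h_below ▸ hl]
  simpa using apply_nextBelow_le h_swap

theorem sum_comp_swap_nextBelow {M : Type*} [Fintype α] [AddCommMonoid M] (A : Finset α)
    (c : α) (f : Perm α → α → M) :
    ∑ π, ∑ i ∈ below A c π, f (π * swap (nextBelow A c π) i) (nextBelow A c π) =
      ∑ π, ∑ i ∈ below A c π, f π i := by
  let X : Finset (Σ _ : Perm α, α) := univ.sigma (below A c)
  let τ (x : Σ _ : Perm α, α) : Σ _ : Perm α, α :=
    ⟨x.1 * swap (nextBelow A c x.1) x.2, nextBelow A c x.1⟩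
  have hτ_mem : ∀ x ∈ X, τ x ∈ X := by
    rintro ⟨π, i⟩ hx
    have hi : i ∈ below A c π := (mem_sigma.1 hx).2
    have h_next := nextBelow_mem ⟨i, hi⟩
    exact mem_sigma.2 ⟨mem_univ _, (below_mul_swap h_next hi).symm ▸ h_next⟩
  have hτ_invol : ∀ x ∈ X, τ (τ x) = x := by
    rintro ⟨π, i⟩ hx
    have hi : i ∈ below A c π := (mem_sigma.1 hx).2
    simp only [τ, nextBelow_mul_swap hi, swap_comm i, mul_assoc, swap_mul_self, mul_one]
  rw [sum_sigma', sum_sigma']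
  exact sum_nbij' τ τ hτ_mem hτ_mem hτ_invol hτ_invol fun _ _ => rfl

theorem below_demote (h : (below A c π).Nonempty) :
    below A c (demote A c π) = (below A c π).erase (nextBelow A c π) := by
  have h_next := nextBelow_mem h
  have h_lt := (mem_below.1 h_next).2
  ext l
  rw [mem_erase, mem_below, demote, Perm.mul_apply, Perm.mul_apply, swap_apply_left]
  rcases eq_or_ne l (nextBelow A c π) with rfl | h_ne
  · simp [h_lt.le]
  rcases eq_or_ne l c with rfl | hlc
  · simp [mem_below]
  rw [swap_apply_of_ne_of_ne hlc h_ne]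
  refine ⟨fun ⟨hlA, hl⟩ => ⟨h_ne, mem_below.2 ⟨hlA, h_lt.trans hl⟩⟩, fun ⟨_, hl⟩ => ?_⟩
  exact ⟨(mem_below.1 hl).1, (apply_nextBelow_le hl).lt_of_ne (π.injective.ne h_ne.symm)⟩

theorem card_below_demote_add_one (h : (below A c π).Nonempty) :
    #(below A c (demote A c π)) + 1 = #(below A c π) := by
  rw [below_demote h, card_erase_add_one (nextBelow_mem h)]

theorem demote_nextBelow_lt (h : (below A c π).Nonempty) :
    demote A c π (nextBelow A c π) < demote A c π c := by
  simpa [demote] using (mem_below.1 (nextBelow_mem h)).2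

theorem demote_le_demote_nextBelow (hi : i ∈ A) (h : demote A c π i < demote A c π c) :
    demote A c π i ≤ demote A c π (nextBelow A c π) := by
  rcases eq_or_ne i (nextBelow A c π) with rfl | h_ne
  · exact le_rfl
  have hic : i ≠ c := fun e => h.ne (congrArg _ e)
  simp only [demote, Perm.mul_apply, swap_apply_left, swap_apply_right,
    swap_apply_of_ne_of_ne hic h_ne] at h ⊢
  exact not_lt.1 fun hlt => h.not_ge (apply_nextBelow_le (mem_below.2 ⟨hi, hlt⟩))

-- The exchanged member of `A` is recovered from the new ranking as the last one ranked above `c`.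
theorem injOn_demote (A : Finset α) (c : α) :
    Set.InjOn (demote A c) {π | (below A c π).Nonempty} := by
  intro π hπ ρ hρ h
  have h_next : nextBelow A c π = nextBelow A c ρ := by
    refine (demote A c π).injective (le_antisymm ?_ ?_)
    · have := demote_nextBelow_lt hπ
      rw [h] at this ⊢
      exact demote_le_demote_nextBelow (mem_below.1 (nextBelow_mem hπ)).1 this
    · have := demote_nextBelow_lt hρ
      rw [← h] at this
      exact demote_le_demote_nextBelow (mem_below.1 (nextBelow_mem hρ)).1 this
  rw [demote, demote, h_next] at h
  exact mul_right_cancel h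

end Below

section Excess

variable {n : ℕ} {p : Fin n → ℝ} {A : Finset (Fin n)} {c : Fin n}

theorem sum_rankingWeight_mul_below_le (hp : ∀ i, 0 < p i) (A : Finset (Fin n)) (c : Fin n) :
    ∑ π, ∑ i ∈ below A c π, rankingWeight p π * p i ≤
      ∑ π, #(below A c π) * (rankingWeight p π * p (nextBelow A c π)) := by
  let gain (π : Perm (Fin n)) (i : Fin n) : ℝ :=
    rankingWeight p π * (p (nextBelow A c π) - p i)
  have h_gain (π) (i) (hi : i ∈ below A c π) :
      0 ≤ gain π i + gain (π * swap (nextBelow A c π) i) (nextBelow A c π) := by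
    simp only [gain, nextBelow_mul_swap hi]
    rcases eq_or_ne (nextBelow A c π) i with h_eq | h_ne
    · simp [h_eq]
    · have h_lt := (apply_nextBelow_le hi).lt_of_ne (π.injective.ne h_ne)
      linarith [sub_mul_rankingWeight_sub_nonneg hp h_lt]
  have h_sum : 0 ≤ ∑ π, ∑ i ∈ below A c π, gain π i := by
    have := sum_nonneg fun π (_ : π ∈ univ) => sum_nonneg (h_gain π)
    simp only [sum_add_distrib, sum_comp_swap_nextBelow A c gain] at this
    linarith
  simpa only [gain, mul_sub, sum_sub_distrib, sum_const, nsmul_eq_mul, sub_nonneg] using h_sum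

theorem sum_card_below_mul_le (hp : ∀ i, 0 < p i) (hA : ∀ i ∈ A, p c ≤ p i) :
    ∑ π, #(below A c π) * (rankingWeight p π * p (nextBelow A c π)) ≤
      ∑ π, (#(below A c π) + 1) * (rankingWeight p π * p c) := by
  let N : Finset (Perm (Fin n)) := {π | (below A c π).Nonempty}
  let f (π : Perm (Fin n)) : ℝ := (#(below A c π) + 1) * (rankingWeight p π * p c)
  have hf (π) : 0 ≤ f π :=
    mul_nonneg (by positivity) (mul_pos (rankingWeight_pos hp π) (hp c)).le
  have h_inj : Set.InjOn (demote A c) N := by simpa [N] using injOn_demote A c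
  calc ∑ π, #(below A c π) * (rankingWeight p π * p (nextBelow A c π))
      = ∑ π ∈ N, #(below A c π) * (rankingWeight p π * p (nextBelow A c π)) := by
        refine (sum_filter_of_ne fun π _ h => ?_).symm
        exact card_ne_zero.1 fun h0 => h (by rw [h0, Nat.cast_zero, zero_mul])
    _ ≤ ∑ π ∈ N, f (demote A c π) := by
        refine sum_le_sum fun π hπ => ?_
        have h_ne : (below A c π).Nonempty := (mem_filter.1 hπ).2
        obtain ⟨h_mem, h_lt⟩ := mem_below.1 (nextBelow_mem h_ne)
        simp only [f, ← card_below_demote_add_one h_ne, Nat.cast_add_one]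
        exact mul_le_mul_of_nonneg_left (rankingWeight_mul_le hp (hA _ h_mem) h_lt) (by positivity)
    _ = ∑ π ∈ N.image (demote A c), f π := (sum_image h_inj).symm
    _ ≤ ∑ π, f π := sum_le_univ_sum_of_nonneg hf

theorem sum_rankingWeight_mul_sub_le (hp : ∀ i, 0 < p i) (hA : ∀ i ∈ A, p c ≤ p i) :
    ∑ π, rankingWeight p π * ∑ i ∈ below A c π, (p i - p c) ≤ (∑ π, rankingWeight p π) * p c := by
  have h_le := (sum_rankingWeight_mul_below_le hp A c).trans (sum_card_below_mul_le hp hA)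
  simp only [add_mul, one_mul, sum_add_distrib, ← sum_mul] at h_le
  simp only [mul_sum, mul_sub, sum_sub_distrib, sum_const, nsmul_eq_mul,
    mul_left_comm (rankingWeight p _)]
  linarith

theorem excessBelow_eq_sum_below (p : Fin n → ℝ) (c : Fin n) (π : Perm (Fin n)) :
    excessBelow p c π = ∑ i ∈ below {i | p c < p i} c π, (p i - p c) := by
  have h_max (x : ℝ) : max x 0 = if 0 < x then x else 0 := by
    split_ifs with hx
    exacts [max_eq_left hx.le, max_eq_right (not_lt.1 hx)]
  rw [excessBelow, below, filter_comm]
  simp only [h_max, sub_pos, sum_filter]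

end Excess

theorem corollary2 (n : ℕ) (p : Fin n → ℝ) (hp : ∀ i, 0 < p i) :
    (∃! μ : Equiv.Perm (Fin n) → ℝ, IsStationaryDistribution (gladiatorChain p) μ) ∧
    ∀ μ : Equiv.Perm (Fin n) → ℝ, IsStationaryDistribution (gladiatorChain p) μ →
      ∀ j : Fin n, expectation μ (excessBelow p j) ≤ p j := by
  have h_iff (μ) := (detailedBalance_gladiatorChain p).isStationaryDistribution_iff (μ := μ)
    (rankingWeight_pos hp) (isIrreducible_gladiatorChain hp) (sum_gladiatorChain hp)
  refine ⟨⟨_, (h_iff _).2 rfl, fun μ => (h_iff μ).1⟩, fun μ hμ j => ?_⟩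
  have h_total : 0 < ∑ π, rankingWeight p π :=
    sum_pos (fun π _ => rankingWeight_pos hp π) univ_nonempty
  have h_excess := sum_rankingWeight_mul_sub_le (A := {i | p j < p i}) hp
    fun i hi => (mem_filter.1 hi).2.le
  simp only [(h_iff μ).1 hμ, expectation, Pi.smul_apply, smul_eq_mul, mul_assoc, ← mul_sum,
    excessBelow_eq_sum_below]
  exact (inv_mul_le_iff₀ h_total).2 h_excess
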